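/- Setting. Consider $M$ subsystems, each with $N\ge 1$ real outputs, and stack the outputs in $y\in\mathbb{R}^{NM}$; let $q_k$ be the set of the $N$ indices of the outputs of subsystem $k$. A matrix $B\in\mathbb{R}^{N_z\times NM}$, with one row per sensor, gives relative measurements if for every row $l$ there are subsystems $j,k$ such that $B_{l,m}=0$ for $m\notin q_j\cup q_k$, and $\sum_{m\in q_j}|B_{l,m}|=\sum_{m\in q_j}B_{l,m}=\sum_{m\in q_k}|B_{l,m}|=-\sum_{m\in q_k}B_{l,m}=1$. Its Laplacian is $L=B^TB$, and subsystems $j,k$ are connected if $L_{l,m}\neq0$ for some $l\in q_j$, $m\in q_k$. A spatial structure of dimension $\gamma\in\mathbb{N}$ assigns to each subsystem $k$ a position $p(k)\in\mathbb{R}^\gamma$ such that $\|p(k)-p(l)\|\ge1$ for $k\ne l$ (Euclidean norm). $B$ is a distributed sensing model of range $\rho$ for this structure if it gives relative measurements and connects only subsystems with $\|p(k)-p(l)\|\le\rho$. A sensor (row of $B$) is connected to subsystem $k$ if it has a nonzero entry in $q_k$. Proposition 1. Fix a dimension $\gamma\in\mathbb{N}$, a range $\rho\ge1$ and a bound $D_m\in\mathbb{N}$.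 Then for any real $c>0$ and any integer $N_c>0$ there is an $M_0$, depending only on $\gamma,\rho,D_m,c,N_c$, such that for every $M\ge M_0$ the following holds: for every $N\ge1$, every $N_z$, every spatial structure of dimension $\gamma$ on $M$ subsystems and every distributed sensing model $B\in\mathbb{R}^{N_z\times NM}$ of range $\rho$ for it, in which at most $D_m$ sensors are connected to each subsystem, the Laplacian $L=B^TB$ has at least $N_c$ eigenvalues, counted with multiplicity, smaller than $c$. -/

import Mathlib

/-- A spatial structure of dimension `γ` on `M` subsystems: positions in Euclidean space `ℝ^γ`,
any two of them at distance at least `1`. -/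
structure SpatialStructure (γ M : ℕ) where
  pos : Fin M → EuclideanSpace ℝ (Fin γ)
  one_le_dist : ∀ k l : Fin M, l ≠ k → 1 ≤ ‖pos k - pos l‖

/-- The sensor map `B` has one row per sensor; its column `(k, i)` is the `i`-th output of
subsystem `k`, so that the block `q_k` consists of the columns `(k, i)` with `i : Fin N`.
`B` gives (unit-gain) relative measurements if each row is the difference between a convex
combination of outputs of one subsystem `j` and a convex combination of outputs of one
subsystem `k`. -/
def IsRelativeMeasurement {M N Nz : ℕ} (B : Matrix (Fin Nz) (Fin M × Fin N) ℝ) : Prop :=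
  ∀ l : Fin Nz, ∃ j k : Fin M,
    (∀ m : Fin M × Fin N, m.1 ≠ j → m.1 ≠ k → B l m = 0) ∧
    (∑ i : Fin N, |B l (j, i)| = ∑ i : Fin N, B l (j, i)) ∧
    (∑ i : Fin N, B l (j, i) = 1) ∧
    (∑ i : Fin N, |B l (k, i)| = -∑ i : Fin N, B l (k, i)) ∧
    (-∑ i : Fin N, B l (k, i) = 1)

/-- The (generalized) Laplacian `L = Bᵀ B`. -/
def sensingLaplacian {M N Nz : ℕ} (B : Matrix (Fin Nz) (Fin M × Fin N) ℝ) :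
    Matrix (Fin M × Fin N) (Fin M × Fin N) ℝ :=
  B.transpose * B

/-- The Laplacian is symmetric, so that its eigenvalues can be listed with multiplicity. -/
theorem sensingLaplacian_isHermitian {M N Nz : ℕ}
    (B : Matrix (Fin Nz) (Fin M × Fin N) ℝ) : (sensingLaplacian B).IsHermitian := by
  have h := Matrix.isHermitian_conjTranspose_mul_self B
  rwa [Matrix.conjTranspose_eq_transpose_of_trivial] at h

/-- Subsystems `j` and `k` are connected in the graph of `B`: some entry of the block of `L`
with rows in `q_j` and columns in `q_k` is nonzero. -/
def SubsystemsConnected {M N Nz : ℕ} (B : Matrix (Fin Nz) (Fin M × Fin N) ℝ)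
    (j k : Fin M) : Prop :=
  ∃ a b : Fin N, sensingLaplacian B (j, a) (k, b) ≠ 0

/-- Distributed sensing, i.e. local relative measurements of range `ρ`: relative measurements
that connect only subsystems at distance at most `ρ`. -/
structure IsDistributedSensing {γ M N Nz : ℕ} (S : SpatialStructure γ M) (ρ : ℝ)
    (B : Matrix (Fin Nz) (Fin M × Fin N) ℝ) : Prop where
  relative : IsRelativeMeasurement B
  isLocal : ∀ j k : Fin M, SubsystemsConnected B j k → ‖S.pos j - S.pos k‖ ≤ ρ

/-- The number of sensors connected to subsystem `k`, i.e. of rows of `B` that involve an output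
of subsystem `k`. -/
noncomputable def sensorCount {M N Nz : ℕ} (B : Matrix (Fin Nz) (Fin M × Fin N) ℝ)
    (k : Fin M) : ℕ :=
  {l : Fin Nz | ∃ i : Fin N, B l (k, i) ≠ 0}.ncard

/-! Indicators of balls serve as approximate null vectors of the Laplacian. A sensor takes the
difference of the values at two subsystems within range, so the energy of the indicator of a ball
counts only sensors crossing its boundary: at most `Dm` per subsystem gained when the radius grows
by `ρ`. Packing makes ball sizes grow polynomially in the radius, so they cannot grow by a factor `1
+ ε` at each of `K` steps once `K` is large (`exists_step_le_mul`). Hence every subsystem is the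
centre of a ball of radius below `K * ρ` whose indicator has Rayleigh quotient below `c`, with `K`
independent of `M`. For large `M`, packing also yields `Nc` centres so far apart that no sensor sees
two of their balls. The indicators and their images under `B` are then orthogonal, and a min-max
argument (`card_le_card_eigenvalues_gram_lt`) gives `Nc` eigenvalues below `c`. -/

/-! ### Counting small eigenvalues by test vectors -/

open Matrix in
/-- A Hermitian real matrix whose quadratic form is smaller than `c` times the squared norm on an
`n`-dimensional family of vectors has at least `n` eigenvalues smaller than `c`. -/
theorem le_card_eigenvalues_lt {ι τ : Type*} [Fintype ι] [DecidableEq ι] [Fintype τ]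
    {A : Matrix ι ι ℝ} (hA : A.IsHermitian) (c : ℝ) (v : τ → ι → ℝ)
    (h : ∀ a : τ → ℝ, a ≠ 0 →
      (∑ t, a t • v t) ⬝ᵥ (A *ᵥ ∑ t, a t • v t) < c * ((∑ t, a t • v t) ⬝ᵥ ∑ t, a t • v t)) :
    Fintype.card τ ≤ (Finset.univ.filter fun i => hA.eigenvalues i < c).card := by
  by_contra! hlt
  let b : ι → ι → ℝ := fun i => hA.eigenvectorBasis i
  have parseval : ∀ x y : ι → ℝ, x ⬝ᵥ y = ∑ i, (b i ⬝ᵥ x) * (b i ⬝ᵥ y) := fun x y => by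
    have := hA.eigenvectorBasis.sum_inner_mul_inner (WithLp.toLp 2 x) (WithLp.toLp 2 y)
    simp only [EuclideanSpace.inner_eq_star_dotProduct, star_trivial] at this
    rw [dotProduct_comm, ← this]
    exact Finset.sum_congr rfl fun i _ => by rw [dotProduct_comm y]
  have eig : ∀ i x, b i ⬝ᵥ (A *ᵥ x) = hA.eigenvalues i * (b i ⬝ᵥ x) := fun i x => by
    rw [dotProduct_mulVec, ← mulVec_transpose]
    have hT : Aᵀ = A := by simpa [conjTranspose_eq_transpose_of_trivial] using hA.eq
    rw [hT, hA.mulVec_eigenvectorBasis i, smul_dotProduct, smul_eq_mul]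
  -- With fewer small eigenvalues than coefficients, some nonzero combination is orthogonal to all
  -- their eigenvectors; its quadratic form is then at least `c` times its squared norm.
  let f : (τ → ℝ) →ₗ[ℝ] ({i // hA.eigenvalues i < c} → ℝ) :=
    { toFun := fun a i => b i ⬝ᵥ ∑ t, a t • v t
      map_add' := fun a a' => by
        ext i
        simp [add_smul, Finset.sum_add_distrib]
      map_smul' := fun r a => by
        ext i
        simp [mul_smul, ← Finset.smul_sum] }
  have hker : LinearMap.ker f ≠ ⊥ := f.ker_ne_bot_of_finrank_lt <| by
    rw [Module.finrank_fintype_fun_eq_card, Module.finrank_fintype_fun_eq_card,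
      Fintype.card_subtype]
    exact hlt
  obtain ⟨a, haf, ha⟩ := (Submodule.ne_bot_iff _).1 hker
  have hx := h a ha
  set x := ∑ t, a t • v t
  rw [parseval x (A *ᵥ x), parseval x x, Finset.mul_sum] at hx
  refine absurd hx (not_lt.2 (Finset.sum_le_sum fun i _ => ?_))
  rw [eig]
  by_cases hi : hA.eigenvalues i < c
  · have h0 : b i ⬝ᵥ x = 0 := congrFun (LinearMap.mem_ker.1 haf) ⟨i, hi⟩
    simp [h0]
  · nlinarith [mul_self_nonneg (b i ⬝ᵥ x)]

open Matrix in
/-- The square of the norm of a combination of orthogonal vectors. -/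
theorem sum_smul_dotProduct_sum_smul {ι τ : Type*} [Fintype ι] [Fintype τ] (w : τ → ι → ℝ)
    (a : τ → ℝ) (hw : Pairwise fun s t => w s ⬝ᵥ w t = 0) :
    (∑ t, a t • w t) ⬝ᵥ (∑ t, a t • w t) = ∑ t, a t ^ 2 * (w t ⬝ᵥ w t) := by
  rw [sum_dotProduct]
  refine Finset.sum_congr rfl fun t _ => ?_
  rw [dotProduct_sum, Finset.sum_eq_single t]
  · simp only [smul_dotProduct, dotProduct_smul, smul_eq_mul]
    ring
  · intro s _ hs
    simp [hw hs.symm]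
  · simp

open Matrix in
/-- If vectors are orthogonal with orthogonal images under `B`, and
`‖B v‖² < c ‖v‖²` for each of them, then `Bᵀ B` has that many eigenvalues smaller than `c`. -/
theorem card_le_card_eigenvalues_gram_lt {ι κ τ : Type*} [Fintype ι] [DecidableEq ι] [Fintype κ]
    [Fintype τ] (B : Matrix κ ι ℝ) (hB : (Bᵀ * B).IsHermitian) (c : ℝ) (v : τ → ι → ℝ)
    (hv : Pairwise fun s t => v s ⬝ᵥ v t = 0)
    (hBv : Pairwise fun s t => (B *ᵥ v s) ⬝ᵥ (B *ᵥ v t) = 0)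
    (h : ∀ t, (B *ᵥ v t) ⬝ᵥ (B *ᵥ v t) < c * (v t ⬝ᵥ v t)) :
    Fintype.card τ ≤ (Finset.univ.filter fun i => hB.eigenvalues i < c).card := by
  refine le_card_eigenvalues_lt hB c v fun a ha => ?_
  rw [← mulVec_mulVec, dotProduct_mulVec, vecMul_transpose]
  have hlin : B *ᵥ (∑ t, a t • v t) = ∑ t, a t • (B *ᵥ v t) := by
    simp [mulVec_sum, mulVec_smul]
  rw [hlin, sum_smul_dotProduct_sum_smul (fun t => B *ᵥ v t) a hBv,
    sum_smul_dotProduct_sum_smul v a hv, Finset.mul_sum]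
  obtain ⟨t, ht⟩ := Function.ne_iff.1 ha
  have key : ∀ t, c * (a t ^ 2 * (v t ⬝ᵥ v t)) - a t ^ 2 * ((B *ᵥ v t) ⬝ᵥ (B *ᵥ v t)) =
      a t ^ 2 * (c * (v t ⬝ᵥ v t) - (B *ᵥ v t) ⬝ᵥ (B *ᵥ v t)) := fun t => by ring
  refine Finset.sum_lt_sum (fun s _ => ?_) ⟨t, Finset.mem_univ t, ?_⟩
  · rw [← sub_nonneg, key]
    exact mul_nonneg (sq_nonneg _) (sub_pos.2 (h s)).le
  · rw [← sub_pos, key]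
    exact mul_pos (sq_pos_of_ne_zero ht) (sub_pos.2 (h t))

/-! ### Packing and growth -/

open MeasureTheory Metric Module in
/-- At most `(2 r + 1) ^ d` points of a `d`-dimensional space that are pairwise at distance at
least `1` lie in a ball of radius `r`. -/
theorem card_le_of_one_le_dist {E ι : Type*} [NormedAddCommGroup E] [NormedSpace ℝ E]
    [FiniteDimensional ℝ E] (s : Finset ι) (p : ι → E) (x : E) {r : ℝ} (hr : 0 ≤ r)
    (hs : ∀ i ∈ s, dist (p i) x ≤ r) (h : ∀ i ∈ s, ∀ j ∈ s, i ≠ j → 1 ≤ dist (p i) (p j)) :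
    (s.card : ℝ) ≤ (2 * r + 1) ^ finrank ℝ E := by
  borelize E
  let μ : Measure E := Measure.addHaar
  have hpos : (0 : ℝ) < 1 / 2 := by norm_num
  have hrpos : 0 < r + 1 / 2 := by positivity
  -- Volume comparison: the disjoint balls of radius `1/2` about the points all fit in one ball of
  -- radius `r + 1/2`.
  have D : Set.PairwiseDisjoint (s : Set ι) fun i => ball (p i) (1 / 2 : ℝ) := by
    intro i hi j hj hij
    apply ball_disjoint_ball
    linarith [h i hi j hj hij]
  have hsub : (⋃ i ∈ s, ball (p i) (1 / 2 : ℝ)) ⊆ ball x (r + 1 / 2) :=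
    Set.iUnion₂_subset fun i hi => ball_subset_ball' (by linarith [hs i hi])
  have I : (s.card : ENNReal) * ENNReal.ofReal ((1 / 2) ^ finrank ℝ E) * μ (ball 0 1) ≤
      ENNReal.ofReal ((r + 1 / 2) ^ finrank ℝ E) * μ (ball 0 1) := by
    rw [← μ.addHaar_ball_of_pos x hrpos]
    refine le_trans (le_of_eq ?_) (measure_mono hsub)
    rw [measure_biUnion_finset D fun _ _ => measurableSet_ball]
    simp only [μ.addHaar_ball_of_pos _ hpos, Finset.sum_const, nsmul_eq_mul, mul_assoc]
  have J := (ENNReal.mul_le_mul_iff_left (measure_ball_pos μ 0 zero_lt_one).ne'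
    measure_ball_lt_top.ne).1 I
  have K := ENNReal.toReal_le_of_le_ofReal (by positivity) J
  rw [ENNReal.toReal_mul, ENNReal.toReal_natCast, ENNReal.toReal_ofReal (by positivity)] at K
  calc (s.card : ℝ) = s.card * (1 / 2) ^ finrank ℝ E * 2 ^ finrank ℝ E := by
        rw [mul_assoc, ← mul_pow]; norm_num
    _ ≤ (r + 1 / 2) ^ finrank ℝ E * 2 ^ finrank ℝ E := by gcongr
    _ = (2 * r + 1) ^ finrank ℝ E := by rw [← mul_pow]; ring

/-- Exponentials outgrow polynomials. -/
theorem exists_polynomial_lt_pow (d : ℕ) (ρ : ℝ) (hρ : 1 ≤ ρ) {q : ℝ} (hq : 1 < q) :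
    ∃ K : ℕ, (2 * (K * ρ) + 1) ^ d < q ^ K := by
  -- For `K ≥ 1` and `ρ ≥ 1`, `2 * (K * ρ) + 1 ≤ 3 * ρ * K`, which explains the threshold `1 / (3 *
  -- ρ) ^ d`.
  have hlim := tendsto_pow_const_div_const_pow_of_one_lt d hq
  have hev := (hlim.eventually (gt_mem_nhds (show (0 : ℝ) < 1 / (3 * ρ) ^ d by positivity))).and
    (Filter.eventually_ge_atTop 1)
  obtain ⟨K, hK, hK1⟩ := hev.exists
  have hK1' : (1 : ℝ) ≤ K := by exact_mod_cast hK1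
  refine ⟨K, ?_⟩
  have hqK : 0 < q ^ K := pow_pos (by linarith) _
  rw [div_lt_div_iff₀ hqK (by positivity), one_mul, ← mul_pow] at hK
  refine lt_of_le_of_lt (pow_le_pow_left₀ (by positivity) ?_ d) hK
  nlinarith

/-- A sequence that starts at `1` or above and is below `q ^ K` at time `K` has a step of
growth factor at most `q` before `K`. -/
theorem exists_step_le_mul {q : ℝ} (hq : 0 ≤ q) (K : ℕ) (b : ℕ → ℝ) (h0 : 1 ≤ b 0)
    (hK : b K < q ^ K) : ∃ n < K, b (n + 1) ≤ q * b n := by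
  by_contra! hcon
  have : ∀ n ≤ K, q ^ n ≤ b n := by
    intro n
    induction n with
    | zero => intro _; simpa using h0
    | succ n ih =>
      intro hn
      rw [pow_succ']
      exact (mul_le_mul_of_nonneg_left (ih (by omega)) hq).trans (hcon n (by omega)).le
  exact absurd hK (not_lt.2 (this K le_rfl))

/-- If every ball of radius `R` holds at most `P` of more than `n * P` points, then there are
`n` points pairwise farther than `R` apart. -/
theorem exists_finset_lt_dist {ι E : Type*} [Fintype ι] [PseudoMetricSpace E] (p : ι → E) {R : ℝ}
    (hR : 0 ≤ R) (P : ℕ) (hP : ∀ i, (Finset.univ.filter fun j => dist (p j) (p i) ≤ R).card ≤ P)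
    (n : ℕ)
    (hn : n * P < Fintype.card ι) :
    ∃ T : Finset ι, T.card = n ∧ ∀ s ∈ T, ∀ t ∈ T, s ≠ t → R < dist (p s) (p t) := by
  classical
  induction n with
  | zero => exact ⟨∅, by simp⟩
  | succ n ih =>
    obtain ⟨T, hT, hsep⟩ := ih (lt_of_le_of_lt (Nat.mul_le_mul_right P n.le_succ) hn)
    -- Greedy choice: the balls about the points already chosen cannot cover everything.
    have hcov : (T.biUnion fun i => Finset.univ.filter fun j => dist (p j) (p i) ≤ R).card <
        (Finset.univ : Finset ι).card := by
      refine lt_of_le_of_lt (Finset.card_biUnion_le_card_mul _ _ P fun i _ => hP i) ?_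
      rw [hT, Finset.card_univ]
      exact lt_of_le_of_lt (Nat.mul_le_mul_right P n.le_succ) hn
    obtain ⟨k, -, hk⟩ := Finset.exists_mem_notMem_of_card_lt_card hcov
    have hfar : ∀ i ∈ T, R < dist (p k) (p i) := by simpa using hk
    have hkT : k ∉ T := fun h => absurd (hfar k h) (by simpa using hR)
    refine ⟨insert k T, by rw [Finset.card_insert_of_notMem hkT, hT], ?_⟩
    intro s hs t ht hst
    rcases Finset.mem_insert.1 hs with rfl | hs'
    · rcases Finset.mem_insert.1 ht with rfl | ht'
      · exact absurd rfl hst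
      · exact hfar t ht'
    · rcases Finset.mem_insert.1 ht with rfl | ht'
      · rw [dist_comm]; exact hfar s hs'
      · exact hsep s hs' t ht' hst

/-! ### Relative measurements and boundary energy -/

/-- If the absolute values of a finite family sum up to its sum, the family is nonnegative. -/
theorem nonneg_of_sum_abs_eq_sum {ι : Type*} [Fintype ι] {f : ι → ℝ}
    (h : ∑ i, |f i| = ∑ i, f i) (i : ι) : 0 ≤ f i := by
  have := (Finset.sum_eq_sum_iff_of_le fun i _ => le_abs_self (f i)).1 h.symm i (Finset.mem_univ i)
  exact abs_eq_self.1 this.symm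

/-- In a map of relative measurements, entries of one sensor at outputs of two different
subsystems never have the same strict sign. -/
theorem IsRelativeMeasurement.mul_nonpos {M N Nz : ℕ} {B : Matrix (Fin Nz) (Fin M × Fin N) ℝ}
    (hB : IsRelativeMeasurement B) (l : Fin Nz) {x y : Fin M} (hxy : x ≠ y) (a b : Fin N) :
    B l (x, a) * B l (y, b) ≤ 0 := by
  obtain ⟨j, k, h0, hj, -, hk, -⟩ := hB l
  have hj' := nonneg_of_sum_abs_eq_sum hj
  have hk' : ∀ i, 0 ≤ -B l (k, i) :=
    nonneg_of_sum_abs_eq_sum (by simpa only [abs_neg, Finset.sum_neg_distrib] using hk)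
  by_cases hx : x = j
  · by_cases hy : y = k
    · subst hx hy
      nlinarith [hj' a, hk' b]
    · rw [h0 (y, b) (fun h => hxy (hx.trans h.symm)) hy, mul_zero]
  · by_cases hx' : x = k
    · by_cases hy : y = j
      · subst hx' hy
        nlinarith [hj' b, hk' a]
      · rw [h0 (y, b) hy (fun h => hxy (hx'.trans h.symm)), mul_zero]
    · rw [h0 (x, a) hx hx', zero_mul]

open Matrix in
/-- A sensor of a distributed sensing model compares two subsystems within range: on vectors that
are constant on subsystems it is the difference of two values. -/
theorem IsDistributedSensing.exists_row {γ M N Nz : ℕ} {S : SpatialStructure γ M} {ρ : ℝ}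
    {B : Matrix (Fin Nz) (Fin M × Fin N) ℝ} (hB : IsDistributedSensing S ρ B) (l : Fin Nz) :
    ∃ j k : Fin M, dist (S.pos j) (S.pos k) ≤ ρ ∧ (∃ i, B l (j, i) ≠ 0) ∧ (∃ i, B l (k, i) ≠ 0) ∧
      ∀ g : Fin M → ℝ, (B *ᵥ fun m => g m.1) l = g j - g k := by
  obtain ⟨j, k, h0, hj, hj1, hk, hk1⟩ := hB.relative l
  have hk1' : ∑ i, B l (k, i) = -1 := by linarith
  have hjk : j ≠ k := by
    rintro rfl
    linarith
  have hja : ∃ i, B l (j, i) ≠ 0 := by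
    by_contra! h
    simp [h] at hj1
  have hkb : ∃ i, B l (k, i) ≠ 0 := by
    by_contra! h
    simp [h] at hk1
  refine ⟨j, k, ?_, hja, hkb, fun g => ?_⟩
  · obtain ⟨a, ha⟩ := hja
    obtain ⟨b, hb⟩ := hkb
    rw [dist_eq_norm]
    refine hB.isLocal j k ⟨a, b, ne_of_lt ?_⟩
    simp only [sensingLaplacian, mul_apply, transpose_apply]
    -- No cancellation between sensors: every term of this entry of `L` is nonpositive, and that of
    -- sensor `l` is negative.
    exact Finset.sum_neg' (fun i _ => hB.relative.mul_nonpos i hjk a b)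
      ⟨l, Finset.mem_univ l,
        lt_of_le_of_ne (hB.relative.mul_nonpos l hjk a b) (mul_ne_zero ha hb)⟩
  · have hsplit : (B *ᵥ fun m => g m.1) l = ∑ x, g x * ∑ i, B l (x, i) := by
      simp only [mulVec, dotProduct, Fintype.sum_prod_type, Finset.mul_sum]
      exact Finset.sum_congr rfl fun x _ => Finset.sum_congr rfl fun i _ => mul_comm _ _
    rw [hsplit, Fintype.sum_eq_add j k hjk, hj1, hk1']
    · ring
    · rintro x ⟨hxj, hxk⟩
      rw [Finset.sum_eq_zero fun i _ => h0 (x, i) hxj hxk, mul_zero]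

open Matrix in
/-- The energy of the indicator of a set `s` of subsystems is at most the number of sensors
connected to the subsystems outside `s` and within range of `s`. -/
theorem IsDistributedSensing.energy_indicator_le {γ M N Nz : ℕ} {S : SpatialStructure γ M} {ρ : ℝ}
    {B : Matrix (Fin Nz) (Fin M × Fin N) ℝ} (hB : IsDistributedSensing S ρ B) {Dm : ℕ}
    (hDm : ∀ k, sensorCount B k ≤ Dm) (s t : Finset (Fin M)) (hst : s ⊆ t)
    (ht : ∀ j k, j ∈ s → dist (S.pos j) (S.pos k) ≤ ρ → k ∈ t) :
    (B *ᵥ fun m => if m.1 ∈ s then 1 else 0) ⬝ᵥ (B *ᵥ fun m => if m.1 ∈ s then 1 else 0) ≤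
      Dm * ((t.card : ℝ) - s.card) := by
  classical
  let rows : Fin M → Finset (Fin Nz) := fun k => Finset.univ.filter fun l => ∃ i, B l (k, i) ≠ 0
  have hrows : ∀ k, (rows k).card ≤ Dm := fun k => by
    refine le_trans (le_of_eq ?_) (hDm k)
    rw [sensorCount, Set.ncard_eq_toFinset_card']
    congr 1
    ext l
    simp [rows]
  let E := (t \ s).biUnion rows
  have hE : (E.card : ℝ) ≤ Dm * ((t.card : ℝ) - s.card) := by
    have h1 : E.card ≤ (t \ s).card * Dm := Finset.card_biUnion_le_card_mul _ _ _ fun k _ => hrows k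
    have h2 : ((t \ s).card : ℝ) = t.card - s.card := by
      rw [Finset.card_sdiff_of_subset hst, Nat.cast_sub (Finset.card_le_card hst)]
    calc (E.card : ℝ) ≤ (t \ s).card * Dm := by exact_mod_cast h1
      _ = Dm * ((t.card : ℝ) - s.card) := by rw [h2, mul_comm]
  refine le_trans ?_ hE
  have hcard : (E.card : ℝ) = ∑ l, if l ∈ E then 1 else 0 := by simp
  rw [hcard]
  refine Finset.sum_le_sum fun l _ => ?_
  obtain ⟨j, k, hjk, hj, hk, hrow⟩ := hB.exists_row l
  rw [hrow fun x => if x ∈ s then 1 else 0]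
  have hmem : ∀ x, x ∈ t → x ∉ s → (∃ i, B l (x, i) ≠ 0) → l ∈ E := fun x hxt hxs hx =>
    Finset.mem_biUnion.2 ⟨x, Finset.mem_sdiff.2 ⟨hxt, hxs⟩, by simpa [rows] using hx⟩
  -- Only a sensor with exactly one end in `s` contributes, namely `1`; its other end lies in `t \
  -- s`.
  by_cases hjs : j ∈ s <;> by_cases hks : k ∈ s
  · simp only [hjs, hks, if_true]; split_ifs <;> norm_num
  · simp [hjs, hks, hmem k (ht j k hjs hjk) hks hk]
  · simp [hjs, hks, hmem j (ht k j hks (by rwa [dist_comm])) hjs hj]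
  · simp only [hjs, hks, if_false]; split_ifs <;> norm_num

/-! ### Slowly growing balls and the conclusion -/

/-- A ball of radius `r` about a subsystem holds at most `(2 r + 1) ^ γ` subsystems. -/
theorem SpatialStructure.card_ball_le {γ M : ℕ} (S : SpatialStructure γ M) (x : Fin M) {r : ℝ}
    (hr : 0 ≤ r) :
    ((Finset.univ.filter fun j => dist (S.pos j) (S.pos x) ≤ r).card : ℝ) ≤ (2 * r + 1) ^ γ := by
  have := card_le_of_one_le_dist (Finset.univ.filter fun j => dist (S.pos j) (S.pos x) ≤ r)
    S.pos (S.pos x) hr (fun i hi => (Finset.mem_filter.1 hi).2)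
    (fun i _ j _ hij => by rw [dist_eq_norm]; exact S.one_le_dist i j hij.symm)
  rwa [finrank_euclideanSpace_fin] at this

/-- If `q ^ K` exceeds the packing bound at radius `K * ρ`, each point of a spatial structure is
the centre of a ball of radius `n * ρ`, `n < K`,
whose number of points grows at most by the factor `q` when the radius is increased by `ρ`. -/
theorem SpatialStructure.exists_slow_growth {γ M K : ℕ} (S : SpatialStructure γ M) {ρ q : ℝ}
    (hρ : 0 ≤ ρ) (hq : 0 ≤ q) (hK : (2 * (K * ρ) + 1) ^ γ < q ^ K) (x : Fin M) :
    ∃ n < K, ((Finset.univ.filter fun j => dist (S.pos j) (S.pos x) ≤ (n + 1 : ℕ) * ρ).card : ℝ) ≤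
      q * (Finset.univ.filter fun j => dist (S.pos j) (S.pos x) ≤ n * ρ).card := by
  refine exists_step_le_mul hq K
    (fun n => (Finset.univ.filter fun j => dist (S.pos j) (S.pos x) ≤ n * ρ).card) ?_ ?_
  · exact_mod_cast Finset.card_pos.2 ⟨x, by simp⟩
  · exact lt_of_le_of_lt (S.card_ball_le x (by positivity)) hK

theorem proposition1 (γ : ℕ) (ρ : ℝ) (hρ : 1 ≤ ρ) (Dm : ℕ)
    (c : ℝ) (hc : 0 < c) (Nc : ℕ) (hNc : 0 < Nc) :
    ∃ M₀ : ℕ, ∀ M : ℕ, M₀ ≤ M → ∀ N Nz : ℕ, 0 < N →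
      ∀ (S : SpatialStructure γ M) (B : Matrix (Fin Nz) (Fin M × Fin N) ℝ),
        IsDistributedSensing S ρ B → (∀ k : Fin M, sensorCount B k ≤ Dm) →
          Nc ≤ (Finset.univ.filter fun i : Fin M × Fin N =>
            (sensingLaplacian_isHermitian B).eigenvalues i < c).card := by
  classical
  have hρ0 : 0 ≤ ρ := by linarith
  -- The `+ 1` makes `Dm * ε < c` and also covers `Dm = 0`.
  let ε : ℝ := c / (Dm + 1)
  have hε : 0 < ε := by positivity
  have hDε : Dm * ε < c := by
    rw [mul_div_assoc', div_lt_iff₀ (by positivity)]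
    nlinarith
  obtain ⟨K, hK⟩ := exists_polynomial_lt_pow γ ρ hρ (q := 1 + ε) (by linarith)
  -- Two ball radii of at most `K * ρ` each, plus one sensor range.
  let R : ℝ := (2 * K + 1) * ρ
  have hR : 0 ≤ R := by positivity
  let P : ℕ := ⌊(2 * R + 1) ^ γ⌋₊
  refine ⟨Nc * P + 1, fun M hM N Nz hN S B hB hDm => ?_⟩
  have hP : ∀ i, (Finset.univ.filter fun j => dist (S.pos j) (S.pos i) ≤ R).card ≤ P := fun i =>
    Nat.le_floor (S.card_ball_le i hR)
  obtain ⟨T, hT, hsep⟩ := exists_finset_lt_dist S.pos hR P hP Nc (by rw [Fintype.card_fin]; omega)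
  choose n hnK hn using S.exists_slow_growth hρ0 (by linarith) hK
  let A : Fin M → Finset (Fin M) := fun x =>
    Finset.univ.filter fun j => dist (S.pos j) (S.pos x) ≤ n x * ρ
  have hA : ∀ {x j}, j ∈ A x → dist (S.pos j) (S.pos x) ≤ K * ρ := fun {x j} hj =>
    (Finset.mem_filter.1 hj).2.trans <|
      mul_le_mul_of_nonneg_right (by exact_mod_cast (hnK x).le) hρ0
  -- different balls are out of range of each other
  have hfar : ∀ s t : T, s ≠ t → ∀ j k, dist (S.pos j) (S.pos k) ≤ ρ → j ∈ A s → k ∉ A t := by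
    intro s t hst j k hjk hj hk
    have h1 := hsep s s.2 t t.2 (Subtype.coe_ne_coe.2 hst)
    have h2 := dist_triangle4 (S.pos s) (S.pos j) (S.pos k) (S.pos t)
    have h3 := hA hj
    have h4 := hA hk
    rw [dist_comm] at h3
    have : R = K * ρ + ρ + K * ρ := by simp only [R]; ring
    linarith
  have key := card_le_card_eigenvalues_gram_lt B (sensingLaplacian_isHermitian B) c
    (fun t : T => fun m : Fin M × Fin N => if m.1 ∈ A t then (1 : ℝ) else 0) ?_ ?_ ?_
  · rwa [Fintype.card_coe, hT] at key
  · intro s t hst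
    refine Finset.sum_eq_zero fun m _ => ?_
    by_cases hs : m.1 ∈ A s
    · simp [hfar s t hst m.1 m.1 (by simpa using hρ0) hs]
    · simp [hs]
  · intro s t hst
    refine Finset.sum_eq_zero fun l _ => ?_
    -- If one end of sensor `l` lies in `A s`, both ends lie outside `A t`, so the images have
    -- disjoint supports.
    obtain ⟨j, k, hjk, -, -, hrow⟩ := hB.exists_row l
    rw [hrow fun x => if x ∈ A s then 1 else 0, hrow fun x => if x ∈ A t then 1 else 0]
    have hself : ∀ x, dist (S.pos x) (S.pos x) ≤ ρ := fun x => by simpa using hρ0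
    have hjk' : dist (S.pos k) (S.pos j) ≤ ρ := by rwa [dist_comm]
    by_cases hj : j ∈ A s
    · simp [hfar s t hst j j (hself j) hj, hfar s t hst j k hjk hj]
    · by_cases hk : k ∈ A s
      · simp [hfar s t hst k k (hself k) hk, hfar s t hst k j hjk' hk]
      · simp [hj, hk]
  · intro t
    have hpos : (1 : ℝ) ≤ (A t).card := by
      have hmem : (t : Fin M) ∈ A t := by
        simp only [A, Finset.mem_filter, Finset.mem_univ, true_and, dist_self]
        positivity
      exact_mod_cast Finset.card_pos.2 ⟨_, hmem⟩
    have hnorm : dotProduct (fun m : Fin M × Fin N => if m.1 ∈ A t then (1 : ℝ) else 0)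
        (fun m => if m.1 ∈ A t then (1 : ℝ) else 0) = N * (A t).card := by
      simp only [dotProduct, Fintype.sum_prod_type, mul_ite, mul_one, mul_zero]
      simp [← ite_and, mul_comm]
    have hN1 : (1 : ℝ) ≤ N := by exact_mod_cast hN
    rw [hnorm]
    refine lt_of_le_of_lt (hB.energy_indicator_le hDm (A t)
      (Finset.univ.filter fun j => dist (S.pos j) (S.pos t) ≤ (n t + 1 : ℕ) * ρ) ?_ ?_) ?_
    · intro j hj
      have := (Finset.mem_filter.1 hj).2
      simp only [Finset.mem_filter, Finset.mem_univ, true_and]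
      push_cast
      linarith
    · intro j k hj hjk
      have := (Finset.mem_filter.1 hj).2
      have h2 := dist_triangle (S.pos k) (S.pos j) (S.pos t)
      rw [dist_comm (S.pos k) (S.pos j)] at h2
      simp only [Finset.mem_filter, Finset.mem_univ, true_and]
      push_cast
      linarith
    -- Slow growth bounds the number of subsystems gained by `ε * (A t).card`.
    · calc _ ≤ Dm * (ε * (A t).card) := by
            refine mul_le_mul_of_nonneg_left ?_ (Nat.cast_nonneg _)
            have := hn t
            simp only [A]
            linarith
        _ = (Dm * ε) * (A t).card := by ring
        _ < c * (A t).card := by gcongr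
        _ ≤ c * (N * (A t).card) := by
            gcongr
            nlinarith
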